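/- Let $n\ge 0$, $\ell\ge 0$ and $k\ge 1$ be integers, let $d_1\le\dots\le d_k$ be non-negative integers and let $\alpha=(\alpha_1,\dots,\alpha_k)$ be a $k$-tuple of non-negative integers. For $t\ge 0$ write $N_t=\binom{n+t-1}{t}$ for the dimension of the space $\mathbb{C}[x_1,\dots,x_n]_t$ of forms of degree $t$ (with $N_0=1$ also for $n=0$). A sequence of forms of type $\alpha$ is a sequence $f_1,\dots,f_r\in\mathbb{C}[x_1,\dots,x_n]$, $r=\alpha_1+\dots+\alpha_k$, containing exactly $\alpha_i$ forms of degree $d_i$ for each index $i$ (the zero form being allowed); a property holds for a general such sequence if it holds on a nonempty Zariski-open subset of the affine space of all sequences of forms of type $\alpha$. Let $I=(f_1,\dots,f_r)$ be the generated ideal, $I_t$ the space of forms of degree $t$ in $I$, and $h_I(t)=\dim_{\mathbb{C}} I_t$. 1. If for all $i=1,\dots,k$ $$\sum_{j=1}^{i}\alpha_j N_{\ell+d_k-d_j}+N_{\ell+d_k-d_1}\,(N_{\ell+d_k-d_i}-1)<N_{\ell+d_k},$$ then for a general sequence $f_1,\dots,f_r$ of forms of type $\alpha$ $$h_I(d_k+\ell)=\sum_{i=1}^{k}\alpha_i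 N_{\ell+d_k-d_i}.$$ 2. If $$\sum_{i=1}^{k}\alpha_i N_{\ell+d_k-d_i}>N_{\ell+d_k}+k\,N_{\ell+d_k-d_1}\,(N_{\ell+d_k-d_1}-1),$$ then for a general sequence $f_1,\dots,f_r$ of forms of type $\alpha$ $$I_{d_k+\ell}=\mathbb{C}[x_1,\dots,x_n]_{d_k+\ell}.$$ -/

import Mathlib

open MvPolynomial

/-- `N_t`, the dimension of the space of forms of degree `t` in `n` variables. The natural-number
subtraction truncates only for `n = t = 0`, where the value `1` is the right one. -/
def formDim (n t : ℕ) : ℕ := (n + t - 1).choose t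

/-- Sequences of forms of type `α`: for each `i`, `α i` forms of degree `d i` (possibly zero)
in `ℂ[x₁, …, xₙ]`. The forms are indexed by pairs `⟨i, j⟩` with `j < α i`. -/
abbrev FormSeq (n : ℕ) {k : ℕ} (d α : Fin k → ℕ) : Type :=
  (p : Σ i : Fin k, Fin (α i)) → homogeneousSubmodule (Fin n) ℂ (d p.1)

/-- The coordinates of the affine space `FormSeq n d α`: a member of the sequence together with a
monomial of the corresponding degree. -/
abbrev CoeffIndex (n : ℕ) {k : ℕ} (d α : Fin k → ℕ) : Type :=
  Σ p : (Σ i : Fin k, Fin (α i)), {m : Fin n →₀ ℕ // m.degree = d p.1}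

/-- The vector of all coefficients of a sequence of forms. -/
def FormSeq.coeffs {n k : ℕ} {d α : Fin k → ℕ} (f : FormSeq n d α) : CoeffIndex n d α → ℂ :=
  fun s => coeff s.2.1 (f s.1 : MvPolynomial (Fin n) ℂ)

/-- Zariski-open sets of sequences of forms: complements of the common zero locus of a set of
polynomials in the coefficients. -/
def IsZariskiOpen {n k : ℕ} {d α : Fin k → ℕ} (U : Set (FormSeq n d α)) : Prop :=
  ∃ S : Set (MvPolynomial (CoeffIndex n d α) ℂ), U = {f | ∃ Φ ∈ S, eval f.coeffs Φ ≠ 0}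

/-- `P` holds for a general sequence of forms of type `α`: it holds on a nonempty (hence dense)
Zariski-open set of such sequences. -/
def HoldsForGeneral {n k : ℕ} {d α : Fin k → ℕ} (P : FormSeq n d α → Prop) : Prop :=
  ∃ U : Set (FormSeq n d α), IsZariskiOpen U ∧ U.Nonempty ∧ ∀ f ∈ U, P f

/-- The ideal generated by the forms of the sequence. -/
noncomputable def FormSeq.ideal {n k : ℕ} {d α : Fin k → ℕ} (f : FormSeq n d α) :
    Ideal (MvPolynomial (Fin n) ℂ) :=
  Ideal.span (Set.range fun p => (f p : MvPolynomial (Fin n) ℂ))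

/-- The graded component `I_t` of an ideal `I`: the space of forms of degree `t` lying in `I`. -/
noncomputable def gradedComponent {n : ℕ} (I : Ideal (MvPolynomial (Fin n) ℂ)) (t : ℕ) :
    Submodule ℂ (MvPolynomial (Fin n) ℂ) :=
  I.restrictScalars ℂ ⊓ homogeneousSubmodule (Fin n) ℂ t

/-- The Hilbert function `h_I(t) = dim I_t`. -/
noncomputable def hilbertFn {n : ℕ} (I : Ideal (MvPolynomial (Fin n) ℂ)) (t : ℕ) : ℕ :=
  Module.finrank ℂ (gradedComponent I t)

/-! Put `D = ℓ + d_k`, let `R_t` be the forms of degree `t`, and let `M_f` send `a` to `∑ f_j a_j`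
in `R_D`, with image `V = I_D`. Part 1 says that `M_f` is injective for general `f`, part 2 that it
is onto `R_D`.

At maximal rank, a syzygy `a` of `f` satisfies `M_g a ∈ V` for every `g`
(`generic_apply_mem_range`). So `a_j` lies in a colon space: the forms whose products with all of
`R_{δ_j}`, `δ_j = deg f_j`, lie in `V`. If this space is zero, `a_j = 0`; if it is all of
`R_{D-δ_j}`, then `V = R_D`.

The colon space has a generic dimension `κ`. If adding a general form of any degree already present
left `κ` unchanged, the colon space would survive the exchange of each form for an independent one.
It would then be common to independent general sequences, hence invariant under linear
substitutions, hence zero or everything by irreducibility (`finrank_formColon_of_exchange`). So an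
intermediate `κ` grows under some addition, and likewise drops under some removal.

Part 1: a nonzero colon space in `R_{D-d_i}` becomes full after at most `N_{D-d_i} - 1` additions,
each costing at most `N_{D-d_1}` dimensions, against the hypothesis. This is applied to the forms of
index at most `i`, for each `i`. Part 2: if `V` is never full, at most `k (N_{D-d_1} - 1)` removals
kill all `k` colon spaces; the remaining map is injective, which bounds the number of coefficients.

Genericity is tested on lines, so the parameters may be arbitrary polynomials of which only one
homogeneous component is used; adding, removing and exchanging forms become linear maps of
parameters. One good sequence suffices at the end, since nonvanishing of a determinant is
Zariski-open. -/

/-! ### Line-open sets and genericity -/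

/-- A subset of a complex vector space is line-open if every line through one of its points
leaves it in finitely many points only. -/
def LineOpen {X : Type*} [AddCommGroup X] [Module ℂ X] (U : Set X) : Prop :=
  ∀ x ∈ U, ∀ y, {t : ℂ | x + t • y ∉ U}.Finite

theorem LineOpen.inter {X : Type*} [AddCommGroup X] [Module ℂ X] {U V : Set X}
    (hU : LineOpen U) (hV : LineOpen V) : LineOpen (U ∩ V) := by
  intro x hx y
  refine ((hU x hx.1 y).union (hV x hx.2 y)).subset fun t ht => ?_
  by_contra h
  simp only [Set.mem_union, Set.mem_ofPred_eq, not_or, not_not] at h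
  exact ht ⟨h.1, h.2⟩

/-- The line joining a point of `U` to a point of `V` leaves each of the two sets only finitely
often. -/
theorem LineOpen.inter_nonempty {X : Type*} [AddCommGroup X] [Module ℂ X] {U V : Set X}
    (hU : LineOpen U) (hV : LineOpen V) (hU' : U.Nonempty) (hV' : V.Nonempty) :
    (U ∩ V).Nonempty := by
  obtain ⟨x, hx⟩ := hU'
  obtain ⟨y, hy⟩ := hV'
  have h1 := hU x hx (y - x)
  have h2 := (hV y hy (x - y)).image (fun t => 1 - t)
  obtain ⟨t, ht⟩ := (h1.union h2).exists_notMem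
  simp only [Set.mem_union, Set.mem_ofPred_eq, not_or, not_not, Set.mem_image, not_exists,
    not_and] at ht
  refine ⟨_, ht.1, ?_⟩
  by_contra h
  refine ht.2 (1 - t) ?_ (by ring)
  convert h using 2
  module

/-- The filter of sets containing a nonempty line-open set. -/
def genericFilter (X : Type*) [AddCommGroup X] [Module ℂ X] : Filter X where
  sets := {s | ∃ U ⊆ s, U.Nonempty ∧ LineOpen U}
  univ_sets := ⟨Set.univ, subset_rfl, ⟨0, trivial⟩, fun x _ y => by simp⟩
  sets_of_superset := fun ⟨U, h, h'⟩ hst => ⟨U, h.trans hst, h'⟩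
  inter_sets := fun ⟨U, h, h1, h2⟩ ⟨V, k, k1, k2⟩ =>
    ⟨U ∩ V, Set.inter_subset_inter h k, h2.inter_nonempty k2 h1 k1, h2.inter k2⟩

theorem mem_genericFilter {X : Type*} [AddCommGroup X] [Module ℂ X] {s : Set X} :
    s ∈ genericFilter X ↔ ∃ U ⊆ s, U.Nonempty ∧ LineOpen U := Iff.rfl

instance genericFilter_neBot (X : Type*) [AddCommGroup X] [Module ℂ X] :
    (genericFilter X).NeBot := by
  rw [Filter.neBot_iff]
  intro h
  obtain ⟨U, hU, ⟨x, hx⟩, -⟩ := mem_genericFilter.1 (h ▸ Filter.mem_bot : ∅ ∈ genericFilter X)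
  exact hU hx

theorem tendsto_genericFilter {X Y : Type*} [AddCommGroup X] [Module ℂ X] [AddCommGroup Y]
    [Module ℂ Y] (L : X →ₗ[ℂ] Y) (hL : Function.Surjective L) :
    Filter.Tendsto L (genericFilter X) (genericFilter Y) := by
  rintro s ⟨U, hU, hne, ho⟩
  refine ⟨L ⁻¹' U, Set.preimage_mono hU, hne.preimage hL, fun x hx y => ?_⟩
  simpa using ho (L x) hx (L y)

/-! ### Generic rank of families of linear maps -/

/-- In the coordinates of a left inverse the family has matrix `1 + tN`, whose determinant is a
polynomial in `t` with value `1` at `0`. -/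
theorem LinearIndependent.finite_not_add_smul {ι B : Type*} [Finite ι] [AddCommGroup B]
    [Module ℂ B] {v : ι → B} (hv : LinearIndependent ℂ v) (w : ι → B) :
    {t : ℂ | ¬ LinearIndependent ℂ (fun i => v i + t • w i)}.Finite := by
  classical
  have := Fintype.ofFinite ι
  obtain ⟨g, hg⟩ := (Fintype.linearCombination ℂ v).exists_leftInverse_of_injective
    (LinearMap.ker_eq_bot.2 hv.fintypeLinearCombination_injective)
  have hgv (i : ι) : g (v i) = Pi.single i 1 := by
    simpa using LinearMap.congr_fun hg (Pi.single i 1)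
  let N : Matrix ι ι ℂ := fun i j => g (w i) j
  let p : Polynomial ℂ := (1 + (Polynomial.X : Polynomial ℂ) • N.map Polynomial.C).det
  have hp (t : ℂ) : p.eval t = (1 + t • N).det := by
    rw [← Polynomial.coe_evalRingHom, RingHom.map_det]
    congr 1
    ext i j
    by_cases h : i = j <;> simp [h, mul_comm t]
  have hp0 : p ≠ 0 := fun h => by simpa [h] using hp 0
  refine (p.roots.toFinset.finite_toSet).subset fun t ht => ?_
  by_contra h
  apply ht
  have hd : (1 + t • N).det ≠ 0 := by
    rw [← hp]
    simpa [hp0] using h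
  apply LinearIndependent.of_comp g
  have := Matrix.linearIndependent_rows_of_isUnit
    ((Matrix.isUnit_iff_isUnit_det _).2 (isUnit_iff_ne_zero.2 hd))
  have hrow : (g ∘ fun i => v i + t • w i) = (1 + t • N).row := by
    ext i j
    change g (v i + t • w i) j = (1 : Matrix ι ι ℂ) i j + t * g (w i) j
    simp [hgv, Matrix.one_apply, Pi.single_apply, eq_comm]
  rw [hrow]
  exact this

theorem exists_linearIndependent_comp {A B : Type*} [AddCommGroup A] [Module ℂ A]
    [AddCommGroup B] [Module ℂ B] [FiniteDimensional ℂ A] (M : A →ₗ[ℂ] B) :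
    ∃ a : Fin (Module.finrank ℂ M.range) → A, LinearIndependent ℂ (fun i => M (a i)) := by
  let b := Module.finBasis ℂ M.range
  choose a ha using fun i => (b i).2
  refine ⟨a, ?_⟩
  simp only [ha]
  exact b.linearIndependent.map' M.range.subtype (by simp)

theorem LinearIndependent.card_le_finrank_range {ι A B : Type*} [Fintype ι] [AddCommGroup A]
    [Module ℂ A] [AddCommGroup B] [Module ℂ B] [FiniteDimensional ℂ A] {M : A →ₗ[ℂ] B}
    {b : ι → B} (hb : LinearIndependent ℂ b) (h : ∀ i, b i ∈ M.range) :
    Fintype.card ι ≤ Module.finrank ℂ M.range := by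
  rw [← finrank_span_eq_card hb]
  exact Submodule.finrank_mono (Submodule.span_le.2 (Set.range_subset_iff.2 h))

/-- The family of linear maps `M` is affine on lines. -/
def LineAffine {X A B : Type*} [AddCommGroup X] [Module ℂ X] [AddCommGroup A] [Module ℂ A]
    [AddCommGroup B] [Module ℂ B] (M : X → A →ₗ[ℂ] B) : Prop :=
  ∀ x y, ∃ N : A →ₗ[ℂ] B, ∀ t : ℂ, M (x + t • y) = M x + t • N

theorem LineAffine.lineOpen_le_finrank {X A B : Type*} [AddCommGroup X] [Module ℂ X]
    [AddCommGroup A] [Module ℂ A] [AddCommGroup B] [Module ℂ B] [FiniteDimensional ℂ A]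
    {M : X → A →ₗ[ℂ] B} (hM : LineAffine M) (s : ℕ) :
    LineOpen {x | s ≤ Module.finrank ℂ (M x).range} := by
  intro x hx y
  obtain ⟨N, hN⟩ := hM x y
  obtain ⟨a, ha⟩ := exists_linearIndependent_comp (M x)
  refine (ha.finite_not_add_smul (fun i => N (a i))).subset fun t ht hli => ht ?_
  refine le_trans (show s ≤ _ from hx) ?_
  have := hli.card_le_finrank_range (M := M (x + t • y)) fun i => ⟨a i, by simp [hN]⟩
  simpa using this

theorem LineAffine.exists_generic_rank {X A B : Type*} [AddCommGroup X] [Module ℂ X]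
    [AddCommGroup A] [Module ℂ A] [AddCommGroup B] [Module ℂ B] [FiniteDimensional ℂ A]
    {M : X → A →ₗ[ℂ] B} (hM : LineAffine M) :
    ∃ r, (∀ y, Module.finrank ℂ (M y).range ≤ r) ∧
      ∀ᶠ x in genericFilter X, Module.finrank ℂ (M x).range = r := by
  have hbdd : BddAbove (Set.range fun x => Module.finrank ℂ (M x).range) :=
    ⟨Module.finrank ℂ A, by rintro _ ⟨x, rfl⟩; exact (M x).finrank_range_le⟩
  obtain ⟨x, hx⟩ := Nat.sSup_mem (Set.range_nonempty _) hbdd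
  have hle (y : X) : Module.finrank ℂ (M y).range ≤ Module.finrank ℂ (M x).range := by
    simp only at hx
    rw [hx]
    exact le_csSup hbdd ⟨y, rfl⟩
  exact ⟨_, hle, {y | Module.finrank ℂ (M x).range ≤ Module.finrank ℂ (M y).range},
    fun y hy => le_antisymm (hle y) hy, ⟨x, le_refl (Module.finrank ℂ (M x).range)⟩,
    hM.lineOpen_le_finrank _⟩

/-- At a point of maximal rank of a linear family of linear maps, every member of the family sends
the kernel into the image. -/
theorem generic_apply_mem_range {X A B : Type*} [AddCommGroup X] [Module ℂ X]
    [AddCommGroup A] [Module ℂ A] [AddCommGroup B] [Module ℂ B] [FiniteDimensional ℂ A]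
    (M : X →ₗ[ℂ] A →ₗ[ℂ] B) :
    ∀ᶠ x in genericFilter X, ∀ a, M x a = 0 → ∀ y, M y a ∈ (M x).range := by
  have hM : LineAffine M := fun x y => ⟨M y, fun t => by simp⟩
  obtain ⟨r, hr, hg⟩ := hM.exists_generic_rank
  filter_upwards [hg] with x hx a ha y
  by_contra hy
  obtain ⟨c, hc⟩ := exists_linearIndependent_comp (M x)
  -- For `t ≠ 0` the map at `x + t • y` still attains `M y a`, at `t⁻¹ • a`. Independence survives
  -- for almost all `t`, so the rank would exceed its maximum.
  have hli : LinearIndependent ℂ (Fin.cons (M y a) fun i => M x (c i) : Fin (_ + 1) → B) := by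
    rw [linearIndependent_finCons]
    refine ⟨hc, fun h => hy (Submodule.span_le.2 ?_ h)⟩
    rintro _ ⟨i, rfl⟩
    exact ⟨_, rfl⟩
  have hfin := hli.finite_not_add_smul (Fin.cons 0 fun i => M y (c i))
  obtain ⟨t, ht⟩ := (hfin.union (Set.finite_singleton 0)).exists_notMem
  simp only [Set.mem_union, Set.mem_ofPred_eq, Set.mem_singleton_iff, not_or, not_not] at ht
  have := ht.1.card_le_finrank_range (M := M (x + t • y)) fun i => by
    refine Fin.cases ?_ (fun j => ?_) i
    · exact ⟨t⁻¹ • a, by simp [ha, ht.2]⟩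
    · exact ⟨c j, by simp⟩
  have h2 := hr (x + t • y)
  rw [Fintype.card_fin] at this
  omega

/-! ### Generic dimension of colon spaces -/

/-- The vectors of `E` that the pairing `μ` multiplies into the subspace `V`. -/
def pairingColon {E C B : Type*} [AddCommGroup E] [Module ℂ E] [AddCommGroup C] [Module ℂ C]
    [AddCommGroup B] [Module ℂ B] (μ : E →ₗ[ℂ] C →ₗ[ℂ] B) (V : Submodule ℂ B) :
    Submodule ℂ E where
  carrier := {g | ∀ h, μ g h ∈ V}
  add_mem' := fun ha hb h => by simpa using V.add_mem (ha h) (hb h)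
  zero_mem' := fun h => by simp
  smul_mem' := fun c g hg h => by simpa using V.smul_mem c (hg h)

/-- The linear map whose kernel consists of the pairs `(g, u)` with `μ g = M ∘ u`. -/
def pairingDefect {A E C B : Type*} [AddCommGroup A] [Module ℂ A] [AddCommGroup E] [Module ℂ E]
    [AddCommGroup C] [Module ℂ C] [AddCommGroup B] [Module ℂ B] (μ : E →ₗ[ℂ] C →ₗ[ℂ] B)
    (M : A →ₗ[ℂ] B) : (E × (C →ₗ[ℂ] A)) →ₗ[ℂ] (C →ₗ[ℂ] B) :=
  μ.coprod (-(LinearMap.compRight ℂ M))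

/-- The kernel of the defect projects onto the colon space with fibre `Hom(C, ker M)`; rank-nullity
does the rest. -/
theorem finrank_range_pairingDefect {A E C B : Type*} [AddCommGroup A] [Module ℂ A]
    [AddCommGroup E] [Module ℂ E] [AddCommGroup C] [Module ℂ C] [AddCommGroup B] [Module ℂ B]
    [FiniteDimensional ℂ A] [FiniteDimensional ℂ E] [FiniteDimensional ℂ C]
    (μ : E →ₗ[ℂ] C →ₗ[ℂ] B) (M : A →ₗ[ℂ] B) :
    Module.finrank ℂ (pairingDefect μ M).range + Module.finrank ℂ (pairingColon μ M.range) =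
      Module.finrank ℂ E + Module.finrank ℂ C * Module.finrank ℂ M.range := by
  have h1 := (pairingDefect μ M).finrank_range_add_finrank_ker
  have hmem (z) : z ∈ (pairingDefect μ M).ker ↔ ∀ h, μ z.1 h = M (z.2 h) := by
    simp [pairingDefect, LinearMap.ext_iff, add_neg_eq_zero]
  let π : (pairingDefect μ M).ker →ₗ[ℂ] E := (LinearMap.fst ℂ _ _).comp (Submodule.subtype _)
  have h2 := π.finrank_range_add_finrank_ker
  have hr : π.range = pairingColon μ M.range := by
    ext g
    constructor
    · rintro ⟨⟨z, hz⟩, rfl⟩ h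
      exact ⟨z.2 h, ((hmem z).1 hz h).symm⟩
    · intro hg
      obtain ⟨s, hs⟩ := M.rangeRestrict.exists_rightInverse_of_surjective M.range_rangeRestrict
      let u : C →ₗ[ℂ] A := s.comp ((μ g).codRestrict M.range hg)
      refine ⟨⟨(g, u), (hmem _).2 fun h => ?_⟩, rfl⟩
      have := congrArg Subtype.val (LinearMap.congr_fun hs ⟨μ g h, hg h⟩)
      exact this.symm
  let κ : π.ker ≃ₗ[ℂ] (C →ₗ[ℂ] M.ker) :=
    { toFun := fun z => z.1.1.2.codRestrict M.ker fun h => by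
        have h0 : z.1.1.1 = 0 := z.2
        have := (hmem _).1 z.1.2 h
        rw [h0] at this
        simpa using this.symm
      map_add' := fun _ _ => rfl
      map_smul' := fun _ _ => rfl
      invFun := fun u => ⟨⟨(0, M.ker.subtype.comp u), (hmem _).2 fun h => by simp⟩, rfl⟩
      left_inv := fun z => by
        have h0 : z.1.1.1 = 0 := z.2
        apply Subtype.ext
        apply Subtype.ext
        exact Prod.ext h0.symm rfl
      right_inv := fun u => rfl }
  have h3 := κ.finrank_eq
  rw [Module.finrank_linearMap] at h3
  have h4 := M.finrank_range_add_finrank_ker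
  rw [Module.finrank_prod, Module.finrank_linearMap, ← h2, hr, h3, ← h4] at h1
  linarith [h1]

/-- The colon dimension is determined by the ranks of two families affine on lines, and each rank is
generically constant. -/
theorem exists_generic_finrank_pairingColon {X A E C B : Type*} [AddCommGroup X] [Module ℂ X]
    [AddCommGroup A] [Module ℂ A] [AddCommGroup E] [Module ℂ E] [AddCommGroup C] [Module ℂ C]
    [AddCommGroup B] [Module ℂ B] [FiniteDimensional ℂ A] [FiniteDimensional ℂ E]
    [FiniteDimensional ℂ C] (μ : E →ₗ[ℂ] C →ₗ[ℂ] B) (M : X →ₗ[ℂ] A →ₗ[ℂ] B) :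
    ∃ κ, ∀ᶠ x in genericFilter X, Module.finrank ℂ (pairingColon μ (M x).range) = κ := by
  have hM : LineAffine M := fun x y => ⟨M y, fun t => by simp⟩
  have hD : LineAffine fun x => pairingDefect μ (M x) := fun x y =>
    ⟨(-(LinearMap.compRight ℂ (M y))).comp (LinearMap.snd ℂ _ _), fun t => by
      refine LinearMap.ext fun z => LinearMap.ext fun h => ?_
      simp [pairingDefect]
      module⟩
  obtain ⟨r, -, hr⟩ := hM.exists_generic_rank
  obtain ⟨s, -, hs⟩ := hD.exists_generic_rank
  refine ⟨Module.finrank ℂ E + Module.finrank ℂ C * r - s, ?_⟩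
  filter_upwards [hr, hs] with x hx hx'
  have := finrank_range_pairingDefect μ (M x)
  rw [hx, hx'] at this
  omega

/-! ### Forms and linear substitutions -/

/-- The forms of degree `t` in `n` variables. -/
abbrev Forms (n t : ℕ) : Submodule ℂ (MvPolynomial (Fin n) ℂ) := homogeneousSubmodule (Fin n) ℂ t

instance finiteDimensional_forms (n t : ℕ) : FiniteDimensional ℂ (Forms n t) :=
  Module.Finite.iff_fg.2 (homogeneousSubmodule_fg (Fin n) ℂ t)

instance finite_monomials (n t : ℕ) : Finite {m : Fin n →₀ ℕ // m.degree = t} := by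
  refine Finite.of_equiv (Sym (Fin n) t)
    ((Sym.equivNatSum (Fin n) t).trans (Equiv.subtypeEquivRight ?_))
  intro m
  simp [Finsupp.degree_eq_sum, Finsupp.sum_fintype]

theorem finrank_forms (n t : ℕ) : Module.finrank ℂ (Forms n t) = formDim n t := by
  have h1 : Module.finrank ℂ (Forms n t) =
      Module.finrank ℂ (AddMonoidAlgebra.supported ℂ ℂ {m : Fin n →₀ ℕ | m.degree = t}) := by
    rw [← homogeneousSubmodule_eq_finsupp_supported]
  have h2 : Nat.card {m : Fin n →₀ ℕ | m.degree = t} = formDim n t := by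
    rw [formDim, ← Nat.multichoose_eq, ← Sym.card_sym_fin_eq_multichoose, ← Nat.card_eq_fintype_card]
    refine Nat.card_congr ((Sym.equivNatSum (Fin n) t).trans (Equiv.subtypeEquivRight ?_)).symm
    intro m
    simp [Finsupp.degree_eq_sum, Finsupp.sum_fintype]
  rw [h1, (AddMonoidAlgebra.supportedEquivFinsupp _).finrank_eq, ← h2]
  have : Finite {m : Fin n →₀ ℕ | m.degree = t} := finite_monomials n t
  have := Fintype.ofFinite {m : Fin n →₀ ℕ | m.degree = t}
  rw [Module.finrank_finsupp_self, Nat.card_eq_fintype_card]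

theorem forms_mul (n c e : ℕ) : Forms n (c + e) = Forms n c * Forms n e := by
  rw [Forms, Forms, Forms, ← homogeneousSubmodule_one_pow ℂ (c + e), pow_add,
    homogeneousSubmodule_one_pow, homogeneousSubmodule_one_pow]

/-- The linear substitution `xᵢ ↦ ∑ⱼ Aᵢⱼ xⱼ`. -/
noncomputable def linearSubst {n : ℕ} (A : Matrix (Fin n) (Fin n) ℂ) :
    MvPolynomial (Fin n) ℂ →ₐ[ℂ] MvPolynomial (Fin n) ℂ :=
  aeval fun i => ∑ j, C (A i j) * X j

theorem isHomogeneous_linearForm {n : ℕ} (a : Fin n → ℂ) :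
    (∑ j, C (a j) * X j : MvPolynomial (Fin n) ℂ).IsHomogeneous 1 :=
  IsHomogeneous.sum _ _ _ fun _ _ => isHomogeneous_C_mul_X _ _

theorem isHomogeneous_linearSubst {n t : ℕ} (A : Matrix (Fin n) (Fin n) ℂ)
    {p : MvPolynomial (Fin n) ℂ} (hp : p.IsHomogeneous t) : (linearSubst A p).IsHomogeneous t := by
  have := hp.aeval (fun i => ∑ j, C (A i j) * X j) (n := 1) fun i => isHomogeneous_linearForm _
  rwa [one_mul] at this

theorem linearSubst_linearSubst {n : ℕ} (A B : Matrix (Fin n) (Fin n) ℂ)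
    (p : MvPolynomial (Fin n) ℂ) :
    linearSubst A (linearSubst B p) = linearSubst (B * A) p := by
  have : (linearSubst A).comp (linearSubst B) = linearSubst (B * A) := by
    refine MvPolynomial.algHom_ext fun i => ?_
    simp only [linearSubst, AlgHom.comp_apply, aeval_X, map_sum, map_mul, algHom_C,
      Matrix.mul_apply, Finset.sum_mul, Finset.mul_sum, algebraMap_eq]
    rw [Finset.sum_comm]
    simp only [mul_assoc]
  exact DFunLike.congr_fun this p

theorem linearSubst_one {n : ℕ} (p : MvPolynomial (Fin n) ℂ) : linearSubst 1 p = p := by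
  have : linearSubst (1 : Matrix (Fin n) (Fin n) ℂ) = AlgHom.id ℂ _ := by
    refine MvPolynomial.algHom_ext fun i => ?_
    simp [linearSubst, Matrix.one_apply, apply_ite]
  rw [this]; rfl

theorem linearSubst_inv {n : ℕ} {A : Matrix (Fin n) (Fin n) ℂ} (hA : IsUnit A.det)
    (p : MvPolynomial (Fin n) ℂ) : linearSubst A (linearSubst A⁻¹ p) = p := by
  rw [linearSubst_linearSubst, Matrix.nonsing_inv_mul _ hA, linearSubst_one]

theorem homogeneousComponent_linearSubst {n : ℕ} (A : Matrix (Fin n) (Fin n) ℂ) (t : ℕ)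
    (p : MvPolynomial (Fin n) ℂ) :
    homogeneousComponent t (linearSubst A p) = linearSubst A (homogeneousComponent t p) := by
  have : (homogeneousComponent t).comp (linearSubst A).toLinearMap =
      (linearSubst A).toLinearMap.comp (homogeneousComponent t) := by
    refine MvPolynomial.linearMap_ext fun m => LinearMap.ext fun c => ?_
    have h1 : (monomial m c).IsHomogeneous m.degree := isHomogeneous_monomial c rfl
    have h2 := isHomogeneous_linearSubst A h1
    simp only [LinearMap.comp_apply, AlgHom.toLinearMap_apply]
    rw [homogeneousComponent_of_mem (m := t) h1, homogeneousComponent_of_mem (m := t) h2]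
    split_ifs <;> simp
  exact LinearMap.congr_fun this p

/-- The action of a linear substitution on forms of degree `t`. -/
noncomputable def formSubst {n : ℕ} (t : ℕ) (A : Matrix (Fin n) (Fin n) ℂ) :
    Forms n t →ₗ[ℂ] Forms n t :=
  (linearSubst A).toLinearMap.restrict fun _ hp => isHomogeneous_linearSubst A hp

/-! ### Irreducibility of the space of forms -/

/-- A linear functional applied to a polynomial family is a polynomial function of the
parameters. -/
theorem exists_eval_eq_functional {τ σ : Type*} (φ : MvPolynomial σ ℂ →ₗ[ℂ] ℂ)
    (F : MvPolynomial τ (MvPolynomial σ ℂ)) :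
    ∃ q : MvPolynomial τ ℂ, ∀ s, eval s q = φ (eval (fun i => C (s i)) F) := by
  induction F using MvPolynomial.monomial_add_induction_on with
  | C a => exact ⟨C (φ a), fun s => by simp⟩
  | monomial_add m b F _ _ ih =>
    obtain ⟨q, hq⟩ := ih
    refine ⟨monomial m (φ b) + q, fun s => ?_⟩
    have : (m.prod fun i k => (C (s i) : MvPolynomial σ ℂ) ^ k) = C (m.prod fun i k => s i ^ k) := by
      simp [Finsupp.prod]
    rw [map_add, map_add, map_add, hq, eval_monomial, eval_monomial, this, mul_comm b,
      ← smul_eq_C_mul, map_smul, smul_eq_mul, mul_comm]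

theorem linearSubst_vecMulVec {n e : ℕ} (v t : Fin n → ℂ) {g : MvPolynomial (Fin n) ℂ}
    (hg : g.IsHomogeneous e) :
    linearSubst (Matrix.vecMulVec v t) g = eval v g • (∑ j, C (t j) * X j) ^ e := by
  have h1 (i : Fin n) : ∑ j, C (Matrix.vecMulVec v t i j) * X j =
      (C (v i) * ∑ j, C (t j) * X j : MvPolynomial (Fin n) ℂ) := by
    simp [Matrix.vecMulVec_apply, Finset.mul_sum, mul_assoc]
  rw [linearSubst, aeval_def, eval₂_eq', eval_eq', Finset.sum_smul]
  refine Finset.sum_congr rfl fun m hm => ?_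
  have hdeg : ∑ i, m i = e := by
    rw [← Finsupp.degree_eq_sum]
    by_contra h
    exact (mem_support_iff.1 hm) (hg.coeff_eq_zero h)
  simp only [h1, mul_pow, Finset.prod_mul_distrib, Finset.prod_pow_eq_pow_sum, hdeg]
  simp [smul_eq_C_mul, mul_assoc, algebraMap_eq]

/-- Powers of linear forms span: expanded in `t`, the hypothesis says that `φ` of each monomial
times a multinomial coefficient vanishes, and that coefficient is nonzero in characteristic zero. -/
theorem forms_functional_eq_zero {n e : ℕ} (φ : MvPolynomial (Fin n) ℂ →ₗ[ℂ] ℂ)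
    (h : ∀ t : Fin n → ℂ, φ ((∑ j, C (t j) * X j) ^ e) = 0) {p : MvPolynomial (Fin n) ℂ}
    (hp : p.IsHomogeneous e) : φ p = 0 := by
  classical
  let mon (k : Fin n → ℕ) : Fin n →₀ ℕ := Finsupp.equivFunOnFinite.symm k
  let q : MvPolynomial (Fin n) ℂ := ∑ k ∈ Finset.piAntidiag Finset.univ e,
    monomial (mon k) ((Nat.multinomial Finset.univ k : ℂ) * φ (monomial (mon k) 1))
  have hmon (k : Fin n → ℕ) (t : Fin n → ℂ) : ∏ i, (C (t i) * X i : MvPolynomial (Fin n) ℂ) ^ k i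
      = (∏ i, t i ^ k i) • monomial (mon k) 1 := by
    rw [smul_eq_C_mul, monomial_eq, Finsupp.prod_fintype _ _ (fun i => pow_zero _)]
    simp [mul_pow, Finset.prod_mul_distrib, mon]
  have hq : q = 0 := by
    refine MvPolynomial.funext fun t => ?_
    rw [map_zero, ← h t, Finset.sum_pow_eq_sum_piAntidiag, map_sum, map_sum]
    refine Finset.sum_congr rfl fun k _ => ?_
    rw [hmon, eval_monomial, ← nsmul_eq_mul (_ : ℕ) (_ : MvPolynomial (Fin n) ℂ), map_nsmul,
      map_smul, Finsupp.prod_fintype _ _ (fun i => pow_zero _)]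
    simp [mon]
    ring
  rw [p.as_sum, map_sum]
  refine Finset.sum_eq_zero fun m hm => ?_
  have hdeg : ∑ i, m i = e := by
    rw [← Finsupp.degree_eq_sum]
    by_contra h
    exact (mem_support_iff.1 hm) (hp.coeff_eq_zero h)
  have hm2 : mon (fun i => m i) = m := by ext; simp [mon]
  have h0 : coeff m q = 0 := by rw [hq, coeff_zero]
  rw [coeff_sum, Finset.sum_eq_single (fun i => m i)] at h0
  · rw [hm2, coeff_monomial, if_pos rfl, mul_eq_zero, Nat.cast_eq_zero] at h0
    rw [← mul_one (coeff m p), ← smul_eq_mul, ← smul_monomial, map_smul,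
      h0.resolve_left (Nat.multinomial_pos _ _).ne', smul_zero]
  · intro k _ hk
    rw [coeff_monomial, if_neg]
    rintro rfl
    exact hk (by ext i; simp [mon])
  · intro hk
    exact absurd (Finset.mem_piAntidiag.2 ⟨hdeg, by simp⟩) hk

/-- The forms of a given degree are an irreducible representation of the general linear group. -/
theorem eq_bot_or_eq_top_of_formSubst {n e : ℕ} (W : Submodule ℂ (Forms n e))
    (hW : ∀ A : Matrix (Fin n) (Fin n) ℂ, IsUnit A.det → ∀ g ∈ W, formSubst e A g ∈ W) :
    W = ⊥ ∨ W = ⊤ := by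
  by_contra! hne
  obtain ⟨g, hg, hg0⟩ := W.ne_bot_iff.1 hne.1
  obtain ⟨φ₀, hφ₀, hWφ⟩ := W.exists_le_ker_of_lt_top (lt_top_iff_ne_top.2 hne.2)
  obtain ⟨φ, hφ⟩ := φ₀.exists_extend
  have hφ' (p : Forms n e) : φ p = φ₀ p := LinearMap.congr_fun hφ p
  obtain ⟨v, hv⟩ : ∃ v, eval v (g : MvPolynomial (Fin n) ℂ) ≠ 0 := by
    by_contra! h
    exact hg0 (Subtype.ext (MvPolynomial.funext fun v => by simp [h v]))
  let F : MvPolynomial (Fin n × Fin n) (MvPolynomial (Fin n) ℂ) :=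
    aeval (fun i => ∑ j, X (i, j) * C (X j)) (g : MvPolynomial (Fin n) ℂ)
  obtain ⟨q, hq⟩ := exists_eval_eq_functional φ F
  have hF (A : Matrix (Fin n) (Fin n) ℂ) :
      eval (fun ij => C (A ij.1 ij.2)) F = linearSubst A (g : MvPolynomial (Fin n) ℂ) := by
    simp only [F, linearSubst, aeval_def]
    rw [← coe_eval₂Hom, ← coe_eval₂Hom, ← RingHom.comp_apply]
    congr 1
    refine MvPolynomial.ringHom_ext (fun r => ?_) fun i => ?_
    · simp only [RingHom.comp_apply, coe_eval₂Hom, eval₂_C, IsScalarTower.algebraMap_apply ℂ (MvPolynomial (Fin n) ℂ) (MvPolynomial (Fin n × Fin n) (MvPolynomial (Fin n) ℂ)), algebraMap_eq, eval_C]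
    · simp
  -- The polynomial `A ↦ φ (A · g)` vanishes at invertible `A`, so its product with the determinant
  -- vanishes everywhere.
  have hq0 : q = 0 := by
    have hmul : q * (Matrix.mvPolynomialX (Fin n) (Fin n) ℂ).det = 0 := by
      refine MvPolynomial.funext fun s => ?_
      have hs : (fun ij : Fin n × Fin n => Matrix.of (fun i j => s (i, j)) ij.1 ij.2) = s := rfl
      have hdet : eval s (Matrix.mvPolynomialX (Fin n) (Fin n) ℂ).det =
          (Matrix.of fun i j => s (i, j)).det := by
        rw [RingHom.map_det]
        congr 1
        ext i j
        simp
      rw [map_mul, hdet, map_zero]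
      by_cases h : (Matrix.of fun i j => s (i, j)).det = 0
      · rw [h, mul_zero]
      · have := hWφ (hW _ (isUnit_iff_ne_zero.2 h) g hg)
        rw [LinearMap.mem_ker, ← hφ'] at this
        rw [hq, mul_eq_zero]
        left
        rw [← this]
        exact congrArg φ (hF (Matrix.of fun i j => s (i, j)))
    exact (mul_eq_zero.1 hmul).resolve_right (Matrix.det_mvPolynomialX_ne_zero _ _)
  refine hφ₀ (LinearMap.ext fun p => ?_)
  rw [← hφ', LinearMap.zero_apply]
  refine forms_functional_eq_zero φ (fun t => ?_) p.2
  -- At the rank-one matrix `v tᵀ` the nonzero factor `g(v)` splits off and leaves `φ` of a power of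
  -- a linear form.
  have h1 := hq fun ij => Matrix.vecMulVec v t ij.1 ij.2
  rw [hF, linearSubst_vecMulVec v t g.2, hq0, map_zero, map_smul, eq_comm, smul_eq_zero] at h1
  exact h1.resolve_left hv

/-- Only finitely many generic conditions can be imposed at once. Finitely many substitutions
spanning the same space of endomorphisms as all invertible ones suffice. -/
theorem exists_finset_formSubst (n e : ℕ) :
    ∃ s : Finset (Matrix (Fin n) (Fin n) ℂ), (∀ A ∈ s, IsUnit A.det) ∧
      ∀ W : Submodule ℂ (Forms n e), (∀ A ∈ s, ∀ g ∈ W, formSubst e A g ∈ W) →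
        W = ⊥ ∨ W = ⊤ := by
  classical
  let T : Set (Forms n e →ₗ[ℂ] Forms n e) := formSubst e '' {A | IsUnit A.det}
  obtain ⟨s', hs', hspan⟩ := (Submodule.fg_span_iff_fg_span_finset_subset T).1
    (IsNoetherian.noetherian (Submodule.span ℂ T))
  obtain ⟨s, hs, rfl⟩ := Finset.subset_set_image_iff.1 hs'
  refine ⟨s, fun A hA => hs hA, fun W hW => eq_bot_or_eq_top_of_formSubst W fun A hA => ?_⟩
  let Q : Submodule ℂ (Forms n e →ₗ[ℂ] Forms n e) :=
    { carrier := {f | ∀ g ∈ W, f g ∈ W}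
      add_mem' := fun ha hb g hg => W.add_mem (ha g hg) (hb g hg)
      zero_mem' := fun g _ => W.zero_mem
      smul_mem' := fun c f hf g hg => W.smul_mem c (hf g hg) }
  have hQ : Submodule.span ℂ T ≤ Q := by
    rw [hspan, Submodule.span_le]
    intro f hf
    obtain ⟨B, hB, rfl⟩ := Finset.mem_image.1 (Finset.mem_coe.1 hf)
    exact hW B hB
  exact hQ (Submodule.subset_span ⟨A, hA, rfl⟩)

/-! ### Forms of degree `D` generated by a family -/

/-- The map `(a, f) ↦ ∑ⱼ fⱼ aⱼ` into the forms of degree `D`, where `fⱼ` is replaced by its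
homogeneous component of degree `δ j`. -/
noncomputable def formsMap {n : ℕ} {J : Type} [Fintype J] (D : ℕ) (δ : J → ℕ) :
    (J → MvPolynomial (Fin n) ℂ) →ₗ[ℂ] ((j : J) → Forms n (D - δ j)) →ₗ[ℂ]
      MvPolynomial (Fin n) ℂ :=
  LinearMap.mk₂ ℂ (fun f a => ∑ j, homogeneousComponent (δ j) (f j) * (a j : MvPolynomial (Fin n) ℂ))
    (fun f f' a => by simp [add_mul, Finset.sum_add_distrib])
    (fun c f a => by simp [Finset.smul_sum])
    (fun f a a' => by simp [mul_add, Finset.sum_add_distrib])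
    (fun c f a => by simp [Finset.smul_sum])

theorem formsMap_apply {n : ℕ} {J : Type} [Fintype J] (D : ℕ) (δ : J → ℕ)
    (f : J → MvPolynomial (Fin n) ℂ) (a : (j : J) → Forms n (D - δ j)) :
    formsMap D δ f a =
      ∑ j, homogeneousComponent (δ j) (f j) * (a j : MvPolynomial (Fin n) ℂ) := rfl

/-- The space of forms of degree `D` generated by a family of forms. -/
noncomputable abbrev formsSpan {n : ℕ} {J : Type} [Fintype J] (D : ℕ) (δ : J → ℕ)
    (f : J → MvPolynomial (Fin n) ℂ) : Submodule ℂ (MvPolynomial (Fin n) ℂ) :=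
  (formsMap D δ f).range

theorem mul_mem_formsSpan {n : ℕ} {J : Type} [Fintype J] (D : ℕ) (δ : J → ℕ)
    (f : J → MvPolynomial (Fin n) ℂ) (j : J) {a : MvPolynomial (Fin n) ℂ}
    (ha : a ∈ Forms n (D - δ j)) : homogeneousComponent (δ j) (f j) * a ∈ formsSpan D δ f := by
  classical
  refine ⟨Pi.single j ⟨a, ha⟩, ?_⟩
  rw [formsMap_apply, Finset.sum_eq_single j]
  · simp
  · intro i _ hi
    simp [Pi.single_eq_of_ne hi]
  · simp

theorem formsSpan_le {n : ℕ} {J : Type} [Fintype J] {D : ℕ} {δ : J → ℕ}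
    {f : J → MvPolynomial (Fin n) ℂ} {W : Submodule ℂ (MvPolynomial (Fin n) ℂ)}
    (h : ∀ j, ∀ a ∈ Forms n (D - δ j), homogeneousComponent (δ j) (f j) * a ∈ W) :
    formsSpan D δ f ≤ W := by
  rintro _ ⟨a, rfl⟩
  rw [formsMap_apply]
  exact W.sum_mem fun j _ => h j _ (a j).2

theorem formsSpan_le_forms {n : ℕ} {J : Type} [Fintype J] {D : ℕ} {δ : J → ℕ} (hδ : ∀ j, δ j ≤ D)
    (f : J → MvPolynomial (Fin n) ℂ) : formsSpan D δ f ≤ Forms n D := by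
  refine formsSpan_le fun j a ha => ?_
  have := (homogeneousComponent_isHomogeneous (δ j) (f j)).mul
    ((mem_homogeneousSubmodule _ _).1 ha)
  rwa [Nat.add_sub_cancel' (hδ j)] at this

theorem formsSpan_mono {n : ℕ} {J J' : Type} [Fintype J] [Fintype J'] (D : ℕ) {δ : J → ℕ}
    {δ' : J' → ℕ} {f : J → MvPolynomial (Fin n) ℂ} {f' : J' → MvPolynomial (Fin n) ℂ}
    (h : ∀ j, ∃ j', δ' j' = δ j ∧ f' j' = f j) : formsSpan D δ f ≤ formsSpan D δ' f' := by
  refine formsSpan_le fun j a ha => ?_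
  obtain ⟨j', h1, h2⟩ := h j
  rw [← h1] at ha ⊢
  rw [← h2]
  exact mul_mem_formsSpan D δ' f' j' ha

theorem linearSubst_mem_formsSpan {n : ℕ} {J : Type} [Fintype J] {D : ℕ} {δ : J → ℕ}
    {f : J → MvPolynomial (Fin n) ℂ} (A : Matrix (Fin n) (Fin n) ℂ)
    {p : MvPolynomial (Fin n) ℂ} (hp : p ∈ formsSpan D δ f) :
    linearSubst A p ∈ formsSpan D δ fun j => linearSubst A (f j) := by
  have : formsSpan D δ f ≤
      (formsSpan D δ fun j => linearSubst A (f j)).comap (linearSubst A).toLinearMap := by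
    refine formsSpan_le fun j a ha => ?_
    rw [Submodule.mem_comap, AlgHom.toLinearMap_apply, map_mul, ← homogeneousComponent_linearSubst]
    exact mul_mem_formsSpan D δ (fun j => linearSubst A (f j)) j (isHomogeneous_linearSubst A ha)
  exact this hp

theorem finrank_formsMap_domain (n D : ℕ) {J : Type} [Fintype J] (δ : J → ℕ) :
    Module.finrank ℂ ((j : J) → Forms n (D - δ j)) = ∑ j, formDim n (D - δ j) := by
  rw [Module.finrank_pi_fintype]
  simp only [finrank_forms]

/-! ### Colon spaces of forms -/

/-- Multiplication of forms. -/
noncomputable def formPairing (n e c : ℕ) :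
    Forms n e →ₗ[ℂ] Forms n c →ₗ[ℂ] MvPolynomial (Fin n) ℂ :=
  (LinearMap.mul ℂ (MvPolynomial (Fin n) ℂ)).domRestrict₁₂ (Forms n e) (Forms n c)

/-- The forms `g` of degree `e` such that all products of `g` with forms of degree `c` lie
in `V`. -/
noncomputable abbrev formColon {n : ℕ} (e c : ℕ) (V : Submodule ℂ (MvPolynomial (Fin n) ℂ)) :
    Submodule ℂ (Forms n e) :=
  pairingColon (formPairing n e c) V

theorem mem_formColon {n e c : ℕ} {V : Submodule ℂ (MvPolynomial (Fin n) ℂ)} {g : Forms n e} :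
    g ∈ formColon e c V ↔ ∀ h ∈ Forms n c, (g * h : MvPolynomial (Fin n) ℂ) ∈ V :=
  ⟨fun H h hh => H ⟨h, hh⟩, fun H h => H h h.2⟩

theorem formColon_mono {n e c : ℕ} {V W : Submodule ℂ (MvPolynomial (Fin n) ℂ)} (h : V ≤ W) :
    formColon e c V ≤ formColon e c W := fun _ hg p => h (hg p)

theorem forms_le_of_formColon_eq_top {n e c : ℕ} {V : Submodule ℂ (MvPolynomial (Fin n) ℂ)}
    (h : formColon e c V = ⊤) : Forms n (c + e) ≤ V := by
  rw [forms_mul, Submodule.mul_le]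
  intro p hp g hg
  rw [mul_comm]
  exact mem_formColon.1 (h ▸ Submodule.mem_top : (⟨g, hg⟩ : Forms n e) ∈ formColon e c V) p hp

theorem formSubst_mem_formColon {n : ℕ} {J : Type} [Fintype J] {D e c : ℕ} {δ : J → ℕ}
    {f : J → MvPolynomial (Fin n) ℂ} {A : Matrix (Fin n) (Fin n) ℂ} (hA : IsUnit A.det)
    {g : Forms n e} (hg : g ∈ formColon e c (formsSpan D δ f)) :
    formSubst e A g ∈ formColon e c (formsSpan D δ fun j => linearSubst A (f j)) := by
  refine mem_formColon.2 fun h hh => ?_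
  have := linearSubst_mem_formsSpan A
    (mem_formColon.1 hg _ (isHomogeneous_linearSubst A⁻¹ hh))
  rw [map_mul, linearSubst_inv hA] at this
  exact this

theorem exists_generic_finrank_formColon {n : ℕ} {J : Type} [Fintype J] (D : ℕ) (δ : J → ℕ)
    (e c : ℕ) : ∃ κ, ∀ᶠ f in genericFilter (J → MvPolynomial (Fin n) ℂ),
      Module.finrank ℂ (formColon e c (formsSpan D δ f)) = κ :=
  exists_generic_finrank_pairingColon (formPairing n e c) (formsMap D δ)

/-- In `generic_apply_mem_range`, take the direction with `j`-th entry `h` and all others zero. -/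
theorem generic_mem_formColon_of_ker {n : ℕ} {J : Type} [Fintype J] (D : ℕ) (δ : J → ℕ) :
    ∀ᶠ f in genericFilter (J → MvPolynomial (Fin n) ℂ), ∀ a, formsMap D δ f a = 0 →
      ∀ j, a j ∈ formColon (D - δ j) (δ j) (formsSpan D δ f) := by
  classical
  filter_upwards [generic_apply_mem_range (formsMap (n := n) D δ)] with f hf a ha j
  refine mem_formColon.2 fun h hh => ?_
  have := hf a ha (Pi.single j h)
  rw [formsMap_apply, Finset.sum_eq_single j] at this
  · rwa [Pi.single_eq_same, homogeneousComponent_of_mem (m := δ j) hh, if_pos rfl, mul_comm] at this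
  · intro i _ hi
    simp [Pi.single_eq_of_ne hi]
  · simp

/-! ### Adding, removing and exchanging forms -/

/-- If a generic exchange of a single form does not change the colon space, then it is trivial. -/
theorem finrank_formColon_of_exchange {n : ℕ} {J : Type} [Fintype J] [DecidableEq J] (D : ℕ)
    (δ : J → ℕ) (e c κ : ℕ)
    (hκ : ∀ᶠ f in genericFilter (J → MvPolynomial (Fin n) ℂ),
      Module.finrank ℂ (formColon e c (formsSpan D δ f)) = κ)
    (hx : ∀ p, ∀ᶠ z in genericFilter ((J → MvPolynomial (Fin n) ℂ) × MvPolynomial (Fin n) ℂ),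
      formColon e c (formsSpan D δ z.1) =
        formColon e c (formsSpan D δ (Function.update z.1 p z.2))) :
    κ = 0 ∨ κ = formDim n e := by
  have hmix (S : Finset J) : ∀ᶠ z in genericFilter
      ((J → MvPolynomial (Fin n) ℂ) × (J → MvPolynomial (Fin n) ℂ)),
      formColon e c (formsSpan D δ z.1) =
        formColon e c (formsSpan D δ fun j => if j ∈ S then z.2 j else z.1 j) := by
    induction S using Finset.induction_on with
    | empty => simp
    | insert p S hp ih =>
      -- Since `p ∉ S`, the mixed family and the new `p`-th form are independent parameters, so the
      -- single exchange applies to them.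
      let L : ((J → MvPolynomial (Fin n) ℂ) × (J → MvPolynomial (Fin n) ℂ)) →ₗ[ℂ]
          ((J → MvPolynomial (Fin n) ℂ) × MvPolynomial (Fin n) ℂ) :=
        { toFun := fun z => (fun j => if j ∈ S then z.2 j else z.1 j, z.2 p)
          map_add' := fun z w => by
            refine Prod.ext (funext fun j => ?_) rfl
            by_cases h : j ∈ S <;> simp [h]
          map_smul' := fun t w => by
            refine Prod.ext (funext fun j => ?_) rfl
            by_cases h : j ∈ S <;> simp [h] }
      have hL : Function.Surjective L := fun w => by
        refine ⟨(w.1, Function.update w.1 p w.2), Prod.ext (funext fun j => ?_) ?_⟩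
        · by_cases h : j = p
          · subst h; simp [L, hp]
          · simp [L, h]
        · simp [L]
      filter_upwards [ih, (tendsto_genericFilter L hL).eventually (hx p)] with z h1 h2
      rw [h1]
      refine h2.trans ?_
      congr 2
      funext j
      by_cases h : j = p
      · subst h; simp [L]
      · simp [L, h]
  have hpair : ∀ᶠ z in genericFilter
      ((J → MvPolynomial (Fin n) ℂ) × (J → MvPolynomial (Fin n) ℂ)),
      formColon e c (formsSpan D δ z.1) = formColon e c (formsSpan D δ z.2) := by
    filter_upwards [hmix Finset.univ] with z hz
    simpa using hz
  obtain ⟨s, hs, hirr⟩ := exists_finset_formSubst n e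
  have hsubst : ∀ᶠ z in genericFilter
      ((J → MvPolynomial (Fin n) ℂ) × (J → MvPolynomial (Fin n) ℂ)), ∀ A ∈ s,
      formColon e c (formsSpan D δ z.1) =
        formColon e c (formsSpan D δ fun j => linearSubst A (z.2 j)) := by
    rw [Filter.eventually_all_finset]
    intro A hA
    let L : ((J → MvPolynomial (Fin n) ℂ) × (J → MvPolynomial (Fin n) ℂ)) →ₗ[ℂ]
        ((J → MvPolynomial (Fin n) ℂ) × (J → MvPolynomial (Fin n) ℂ)) :=
      LinearMap.prodMap LinearMap.id ((linearSubst A).toLinearMap.compLeft J)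
    have hL : Function.Surjective L := fun w => by
      refine ⟨(w.1, fun j => linearSubst A⁻¹ (w.2 j)), Prod.ext rfl (funext fun j => ?_)⟩
      simp only [L, LinearMap.prodMap_apply, LinearMap.compLeft_apply, AlgHom.toLinearMap_apply,
        Function.comp_apply, linearSubst_inv (hs A hA)]
    exact (tendsto_genericFilter L hL).eventually hpair
  obtain ⟨z, h1, h2, h3⟩ := (hpair.and (hsubst.and ((tendsto_genericFilter
    (LinearMap.fst ℂ _ _) Prod.fst_surjective).eventually hκ))).exists
  rw [LinearMap.fst_apply] at h3
  -- Apply `A` to the colon space of `z.2`: the result is the colon space of the transformed family,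
  -- which again equals that of `z.1`.
  have hinv : ∀ A ∈ s, ∀ g ∈ formColon e c (formsSpan D δ z.1),
      formSubst e A g ∈ formColon e c (formsSpan D δ z.1) := by
    intro A hA g hg
    rw [h1] at hg
    rw [h2 A hA]
    exact formSubst_mem_formColon (hs A hA) hg
  rcases hirr _ hinv with h | h
  · left
    rw [← h3, h, finrank_bot]
  · right
    rw [← h3, h, finrank_top, finrank_forms]

/-- Otherwise the family, and the family with its `p`-th form exchanged, would both have the colon
space of their union, so no exchange would change it. -/
theorem exists_finrank_formColon_lt_of_add {n : ℕ} {J : Type} [Fintype J] (D : ℕ)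
    (δ : J → ℕ) (e c κ : ℕ)
    (hκ : ∀ᶠ f in genericFilter (J → MvPolynomial (Fin n) ℂ),
      Module.finrank ℂ (formColon e c (formsSpan D δ f)) = κ)
    (h0 : κ ≠ 0) (h1 : κ ≠ formDim n e) :
    ∃ p : J, ∃ κ', κ < κ' ∧ ∀ᶠ f in genericFilter (Option J → MvPolynomial (Fin n) ℂ),
      Module.finrank ℂ (formColon e c (formsSpan D (fun o => o.elim (δ p) δ) f)) = κ' := by
  classical
  by_contra! hcon
  refine (finrank_formColon_of_exchange D δ e c κ hκ fun p => ?_).elim h0 h1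
  obtain ⟨κ', hκ'⟩ := exists_generic_finrank_formColon (n := n) D
    (fun o : Option J => o.elim (δ p) δ) e c
  have hle : κ' ≤ κ := by
    by_contra! h
    exact hcon p κ' h (hκ'.mono fun _ hf hne => hne hf)
  let L : ((J → MvPolynomial (Fin n) ℂ) × MvPolynomial (Fin n) ℂ) →ₗ[ℂ]
      (Option J → MvPolynomial (Fin n) ℂ) :=
    { toFun := fun z o => o.elim z.2 z.1
      map_add' := fun z w => by ext1 o; cases o <;> rfl
      map_smul' := fun t w => by ext1 o; cases o <;> rfl }
  have hL : Function.Surjective L := fun w =>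
    ⟨(fun j => w (some j), w none), by ext1 o; cases o <;> rfl⟩
  let L' : ((J → MvPolynomial (Fin n) ℂ) × MvPolynomial (Fin n) ℂ) →ₗ[ℂ]
      (J → MvPolynomial (Fin n) ℂ) :=
    { toFun := fun z => Function.update z.1 p z.2
      map_add' := fun z w => Function.update_add _ _ _ _ _
      map_smul' := fun t w => Function.update_smul _ _ _ _ }
  have hL' : Function.Surjective L' := fun w => ⟨(w, w p), Function.update_eq_self p w⟩
  filter_upwards [(tendsto_genericFilter L hL).eventually hκ',
    (tendsto_genericFilter L' hL').eventually hκ, (tendsto_genericFilter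
    (LinearMap.fst ℂ _ _) Prod.fst_surjective).eventually hκ] with z hz1 hz2 hz3
  have e1 : formColon e c (formsSpan D δ z.1) =
      formColon e c (formsSpan D (fun o => o.elim (δ p) δ) (L z)) := by
    refine Submodule.eq_of_le_of_finrank_le
      (formColon_mono (formsSpan_mono D fun j => ⟨some j, rfl, rfl⟩)) ?_
    rw [hz1]
    exact hle.trans hz3.ge
  have e2 : formColon e c (formsSpan D δ (Function.update z.1 p z.2)) =
      formColon e c (formsSpan D (fun o => o.elim (δ p) δ) (L z)) := by
    refine Submodule.eq_of_le_of_finrank_le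
      (formColon_mono (formsSpan_mono D fun j => ?_)) ?_
    · by_cases h : j = p
      · subst h
        exact ⟨none, rfl, by simp [L]⟩
      · exact ⟨some j, rfl, by simp [L, h]⟩
    · rw [hz1]
      exact hle.trans hz2.ge
  exact e1.trans e2.symm

/-- Dually, both families would have the colon space of their common part. -/
theorem exists_finrank_formColon_lt_of_remove {n : ℕ} {J : Type} [Fintype J] [DecidableEq J]
    (D : ℕ) (δ : J → ℕ) (e c κ : ℕ)
    (hκ : ∀ᶠ f in genericFilter (J → MvPolynomial (Fin n) ℂ),
      Module.finrank ℂ (formColon e c (formsSpan D δ f)) = κ)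
    (h0 : κ ≠ 0) (h1 : κ ≠ formDim n e) :
    ∃ p : J, ∃ κ', κ' < κ ∧ ∀ᶠ f in genericFilter ({j // j ≠ p} → MvPolynomial (Fin n) ℂ),
      Module.finrank ℂ (formColon e c (formsSpan D (fun j : {j // j ≠ p} => δ j) f)) = κ' := by
  by_contra! hcon
  refine (finrank_formColon_of_exchange D δ e c κ hκ fun p => ?_).elim h0 h1
  obtain ⟨κ', hκ'⟩ := exists_generic_finrank_formColon (n := n) D
    (fun j : {j // j ≠ p} => δ j) e c
  have hle : κ ≤ κ' := by
    by_contra! h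
    exact hcon p κ' h (hκ'.mono fun _ hf hne => hne hf)
  let L : ((J → MvPolynomial (Fin n) ℂ) × MvPolynomial (Fin n) ℂ) →ₗ[ℂ]
      ({j // j ≠ p} → MvPolynomial (Fin n) ℂ) :=
    { toFun := fun z j => z.1 j
      map_add' := fun z w => rfl
      map_smul' := fun t w => rfl }
  have hL : Function.Surjective L := fun w =>
    ⟨(fun j => if h : j ≠ p then w ⟨j, h⟩ else 0, 0), by ext1 j; simp [L, j.2]⟩
  let L' : ((J → MvPolynomial (Fin n) ℂ) × MvPolynomial (Fin n) ℂ) →ₗ[ℂ]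
      (J → MvPolynomial (Fin n) ℂ) :=
    { toFun := fun z => Function.update z.1 p z.2
      map_add' := fun z w => Function.update_add _ _ _ _ _
      map_smul' := fun t w => Function.update_smul _ _ _ _ }
  have hL' : Function.Surjective L' := fun w => ⟨(w, w p), Function.update_eq_self p w⟩
  filter_upwards [(tendsto_genericFilter L hL).eventually hκ',
    (tendsto_genericFilter L' hL').eventually hκ, (tendsto_genericFilter
    (LinearMap.fst ℂ _ _) Prod.fst_surjective).eventually hκ] with z hz1 hz2 hz3
  have e1 : formColon e c (formsSpan D (fun j : {j // j ≠ p} => δ j) (L z)) =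
      formColon e c (formsSpan D δ z.1) := by
    refine Submodule.eq_of_le_of_finrank_le
      (formColon_mono (formsSpan_mono D fun j => ⟨j, rfl, rfl⟩)) ?_
    rw [hz1]
    exact hz3.le.trans hle
  have e2 : formColon e c (formsSpan D (fun j : {j // j ≠ p} => δ j) (L z)) =
      formColon e c (formsSpan D δ (Function.update z.1 p z.2)) := by
    refine Submodule.eq_of_le_of_finrank_le
      (formColon_mono (formsSpan_mono D fun j => ⟨j, rfl, by simp [L, j.2]⟩)) ?_
    rw [hz1]
    exact hz2.le.trans hle
  exact e1.symm.trans e2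

/-! ### Counting additions and removals -/

/-- The condition on `D` matters for `n = 0`, where `N_0 = 1` but `N_t = 0` for `t > 0`. -/
theorem formDim_le_formDim {n e e' D : ℕ} (hD : formDim n D ≠ 0) (h : e ≤ e') (h' : e' ≤ D) :
    formDim n e ≤ formDim n e' := by
  rcases n with _ | m
  · rcases D with _ | D
    · obtain rfl : e' = 0 := by omega
      obtain rfl : e = 0 := by omega
      rfl
    · exact absurd (by simp [formDim]) hD
  · have key (t : ℕ) : formDim (m + 1) t = (m + t).choose m := by
      rw [formDim, show m + 1 + t - 1 = m + t by omega, Nat.choose_symm_add]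
    rw [key, key]
    exact Nat.choose_le_choose m (by omega)

/-- Here `m` bounds the codimension of the colon space. Each addition lowers it at a cost of at most
`N`; at codimension zero the family generates all forms of degree `D`. -/
theorem formDim_le_of_formColon_ne_zero {n : ℕ} (D e c N : ℕ) (hD : c + e = D) (m : ℕ) :
    ∀ {J : Type} [Fintype J] (δ : J → ℕ) (κ : ℕ), (∀ j, formDim n (D - δ j) ≤ N) →
      (∀ᶠ f in genericFilter (J → MvPolynomial (Fin n) ℂ),
        Module.finrank ℂ (formColon e c (formsSpan D δ f)) = κ) →
      κ ≠ 0 → formDim n e ≤ κ + m →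
      formDim n D ≤ ∑ j, formDim n (D - δ j) + m * N := by
  induction m with
  | zero =>
    intro J _ δ κ hN hκ h0 hm
    obtain ⟨f, hf⟩ := hκ.exists
    have htop : formColon e c (formsSpan D δ f) = ⊤ := by
      refine Submodule.eq_top_of_finrank_eq (le_antisymm (Submodule.finrank_le _) ?_)
      rw [finrank_forms, hf]
      exact hm
    have h1 := Submodule.finrank_mono (forms_le_of_formColon_eq_top htop)
    have h2 := (formsMap D δ f).finrank_range_le
    rw [finrank_formsMap_domain] at h2
    rw [hD, finrank_forms] at h1
    rw [zero_mul, add_zero]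
    exact h1.trans h2
  | succ m ih =>
    intro J _ δ κ hN hκ h0 hm
    by_cases h1 : κ = formDim n e
    · have := ih δ κ hN hκ h0 (by omega)
      rw [add_mul]
      omega
    · obtain ⟨p, κ', hlt, hκ'⟩ := exists_finrank_formColon_lt_of_add D δ e c κ hκ h0 h1
      have := ih (fun o : Option J => o.elim (δ p) δ) κ' (fun o => by cases o <;> exact hN _) hκ'
        (by omega) (by omega)
      rw [Fintype.sum_option] at this
      have hp := hN p
      simp only [Option.elim_none, Option.elim_some] at this
      rw [add_mul]
      omega

/-- Here `m` bounds the total of the generic colon dimensions. A suitable removal lowers one of them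
and raises none; when all vanish there are no syzygies. Full colon spaces are excluded because the
family never generates everything, a property inherited by subfamilies. -/
theorem sum_formDim_le_of_forall_not_le {n : ℕ} {I : Type} [Fintype I] (D N : ℕ) (d : I → ℕ)
    (hd : ∀ i, d i ≤ D) (hN : ∀ i, formDim n (D - d i) ≤ N) (m : ℕ) :
    ∀ {J : Type} [Fintype J] (δ : J → ℕ) (κ : I → ℕ), (∀ j, ∃ i, δ j = d i) →
      (∀ i, ∀ᶠ f in genericFilter (J → MvPolynomial (Fin n) ℂ),
        Module.finrank ℂ (formColon (D - d i) (d i) (formsSpan D δ f)) = κ i) →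
      (∀ f : J → MvPolynomial (Fin n) ℂ, ¬ Forms n D ≤ formsSpan D δ f) → ∑ i, κ i ≤ m →
      ∑ j, formDim n (D - δ j) ≤ formDim n D + m * N := by
  classical
  induction m with
  | zero =>
    intro J _ δ κ hδ hκ hV hm
    have hm0 (i) : κ i = 0 := by
      have := Finset.single_le_sum (f := κ) (fun i _ => Nat.zero_le _) (Finset.mem_univ i)
      omega
    obtain ⟨f, hf, hker⟩ := ((Filter.eventually_all.2 hκ).and
      (generic_mem_formColon_of_ker D δ)).exists
    have hinj : (formsMap D δ f).ker = ⊥ := by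
      refine LinearMap.ker_eq_bot'.2 fun a ha => funext fun j => ?_
      have h1 := hker a ha j
      have h2 : Module.finrank ℂ (formColon (D - δ j) (δ j) (formsSpan D δ f)) = 0 := by
        obtain ⟨i, hi⟩ := hδ j
        rw [hi, hf, hm0]
      rw [Submodule.finrank_eq_zero.1 h2] at h1
      exact h1
    have h1 := LinearMap.finrank_range_of_inj (LinearMap.ker_eq_bot.1 hinj)
    have hδD (j : J) : δ j ≤ D := by
      obtain ⟨i, hi⟩ := hδ j
      rw [hi]
      exact hd i
    have h2 := Submodule.finrank_mono (formsSpan_le_forms hδD f)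
    rw [finrank_formsMap_domain] at h1
    rw [finrank_forms] at h2
    rw [zero_mul, add_zero, ← h1]
    exact h2
  | succ m ih =>
    intro J _ δ κ hδ hκ hV hm
    by_cases hz : ∀ i, κ i = 0
    · have := ih δ κ hδ hκ hV (by simp [hz])
      rw [add_mul]
      omega
    · push Not at hz
      obtain ⟨i, hi⟩ := hz
      have hne : κ i ≠ formDim n (D - d i) := by
        intro h
        obtain ⟨f, hf⟩ := (hκ i).exists
        have htop : formColon (D - d i) (d i) (formsSpan D δ f) = ⊤ := by
          refine Submodule.eq_top_of_finrank_eq ?_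
          rw [hf, finrank_forms, h]
        have := forms_le_of_formColon_eq_top htop
        rw [Nat.add_sub_cancel' (hd i)] at this
        exact hV f this
      obtain ⟨p, κ', hlt, hκ'⟩ :=
        exists_finrank_formColon_lt_of_remove D δ (D - d i) (d i) (κ i) (hκ i) hi hne
      choose κs hκs using fun i => exists_generic_finrank_formColon (n := n) D
        (fun j : {j // j ≠ p} => δ j) (D - d i) (d i)
      have hle (i') : κs i' ≤ κ i' := by
        let L : (J → MvPolynomial (Fin n) ℂ) →ₗ[ℂ] ({j // j ≠ p} → MvPolynomial (Fin n) ℂ) :=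
          { toFun := fun z j => z j
            map_add' := fun z w => rfl
            map_smul' := fun t w => rfl }
        have hL : Function.Surjective L := fun w =>
          ⟨fun j => if h : j ≠ p then w ⟨j, h⟩ else 0, by ext1 j; simp [L, j.2]⟩
        obtain ⟨f, h1, h2⟩ :=
          (((tendsto_genericFilter L hL).eventually (hκs i')).and (hκ i')).exists
        rw [← h1, ← h2]
        exact Submodule.finrank_mono
          (formColon_mono (formsSpan_mono D fun j => ⟨j, rfl, rfl⟩))
      have heq : κs i = κ' := by
        obtain ⟨f, h1, h2⟩ := ((hκs i).and hκ').exists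
        rw [← h1, h2]
      have hsum : ∑ i, κs i < ∑ i, κ i :=
        Finset.sum_lt_sum (fun i _ => hle i) ⟨i, Finset.mem_univ i, heq ▸ hlt⟩
      have := ih (fun j : {j // j ≠ p} => δ j) κs (fun j => hδ j) hκs (fun f hf =>
        hV (fun j => if h : j ≠ p then f ⟨j, h⟩ else 0)
          (hf.trans (formsSpan_mono D fun j => ⟨j, rfl, by simp [j.2]⟩))) (by omega)
      rw [Fintype.sum_eq_add_sum_subtype_ne _ p]
      have hp : formDim n (D - δ p) ≤ N := by
        obtain ⟨i, hi⟩ := hδ p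
        rw [hi]
        exact hN i
      rw [add_mul]
      omega

/-! ### Sequences of forms and Zariski-open conditions -/

/-- The family of all polynomials underlying a sequence of forms. -/
def seqCoe (n : ℕ) {k : ℕ} (d α : Fin k → ℕ) :
    FormSeq n d α →ₗ[ℂ] ((Σ i : Fin k, Fin (α i)) → MvPolynomial (Fin n) ℂ) where
  toFun := fun F p => F p
  map_add' := fun _ _ => rfl
  map_smul' := fun _ _ => rfl

/-- The sequence of the homogeneous components of prescribed degrees of a family. -/
noncomputable def toFormSeq {n k : ℕ} (d α : Fin k → ℕ)
    (f : (Σ i : Fin k, Fin (α i)) → MvPolynomial (Fin n) ℂ) : FormSeq n d α :=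
  fun p => ⟨homogeneousComponent (d p.1) (f p), homogeneousComponent_isHomogeneous _ _⟩

/-- The map `a ↦ ∑ₚ Fₚ aₚ` attached to a sequence of forms. -/
noncomputable def seqMap {n k : ℕ} (d α : Fin k → ℕ) (D : ℕ) :
    FormSeq n d α →ₗ[ℂ] ((p : Σ i : Fin k, Fin (α i)) → Forms n (D - d p.1)) →ₗ[ℂ]
      MvPolynomial (Fin n) ℂ :=
  (formsMap D fun p : Σ i : Fin k, Fin (α i) => d p.1).comp (seqCoe n d α)

theorem seqMap_apply {n k : ℕ} {d α : Fin k → ℕ} (D : ℕ) (F : FormSeq n d α)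
    (a : (p : Σ i : Fin k, Fin (α i)) → Forms n (D - d p.1)) :
    seqMap d α D F a = ∑ p, (F p : MvPolynomial (Fin n) ℂ) * a p := by
  refine (formsMap_apply D _ _ a).trans (Finset.sum_congr rfl fun p _ => ?_)
  change homogeneousComponent (d p.1) (F p : MvPolynomial (Fin n) ℂ) * _ = _
  rw [homogeneousComponent_of_mem (m := d p.1) (F p).2, if_pos rfl]

theorem seqMap_toFormSeq {n k : ℕ} {d α : Fin k → ℕ} (D : ℕ)
    (f : (Σ i : Fin k, Fin (α i)) → MvPolynomial (Fin n) ℂ) :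
    seqMap d α D (toFormSeq d α f) = formsMap D (fun p : Σ i : Fin k, Fin (α i) => d p.1) f := by
  refine LinearMap.ext fun a => ?_
  rw [seqMap_apply]
  rfl

theorem homogeneousComponent_mul_of_isHomogeneous {n c D : ℕ} (hc : c ≤ D)
    {F : MvPolynomial (Fin n) ℂ} (hF : F.IsHomogeneous c) (g : MvPolynomial (Fin n) ℂ) :
    homogeneousComponent D (F * g) = F * homogeneousComponent (D - c) g := by
  have : (homogeneousComponent D).comp (LinearMap.mulLeft ℂ F) =
      (LinearMap.mulLeft ℂ F).comp (homogeneousComponent (D - c)) := by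
    refine MvPolynomial.linearMap_ext fun m => LinearMap.ext fun r => ?_
    have h1 : (monomial m r).IsHomogeneous m.degree := isHomogeneous_monomial r rfl
    simp only [LinearMap.comp_apply, LinearMap.mulLeft_apply]
    rw [homogeneousComponent_of_mem (m := D - c) h1, homogeneousComponent_of_mem (m := D) (hF.mul h1)]
    by_cases h : m.degree = D - c
    · rw [if_pos (by omega), if_pos (by omega)]
    · rw [if_neg (by omega), if_neg (by omega), mul_zero]
  exact LinearMap.congr_fun this g

/-- Taking degree `D` components of an ideal relation makes its coefficients homogeneous. -/
theorem range_seqMap {n k : ℕ} {d α : Fin k → ℕ} {D : ℕ} (hd : ∀ i, d i ≤ D)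
    (F : FormSeq n d α) : (seqMap d α D F).range = gradedComponent F.ideal D := by
  apply le_antisymm
  · rintro _ ⟨a, rfl⟩
    rw [seqMap_apply]
    refine Submodule.sum_mem _ fun p _ => ⟨?_, ?_⟩
    · exact Ideal.mul_mem_right _ _ (Ideal.subset_span ⟨p, rfl⟩)
    · have := IsHomogeneous.mul (F p).2 (a p).2
      rwa [Nat.add_sub_cancel' (hd p.1)] at this
  · rintro x ⟨hx, hxD⟩
    obtain ⟨g, rfl⟩ := (Ideal.mem_span_range_iff_exists_fun).1 hx
    refine ⟨fun p => ⟨homogeneousComponent (D - d p.1) (g p),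
      homogeneousComponent_isHomogeneous _ _⟩, ?_⟩
    have h1 := homogeneousComponent_of_mem (m := D) hxD
    rw [if_pos rfl, map_sum] at h1
    rw [seqMap_apply, ← h1]
    refine Finset.sum_congr rfl fun p _ => ?_
    rw [mul_comm (g p), homogeneousComponent_mul_of_isHomogeneous (hd p.1) (F p).2]

theorem exists_eval_coeffs_eq {n k : ℕ} {d α : Fin k → ℕ} (φ : FormSeq n d α →ₗ[ℂ] ℂ) :
    ∃ q : MvPolynomial (CoeffIndex n d α) ℂ, ∀ F : FormSeq n d α, eval F.coeffs q = φ F := by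
  classical
  have (p : Σ i : Fin k, Fin (α i)) := Fintype.ofFinite {m : Fin n →₀ ℕ // m.degree = d p.1}
  let b (s : CoeffIndex n d α) : FormSeq n d α :=
    Pi.single s.1 ⟨monomial s.2.1 1, isHomogeneous_monomial 1 s.2.2⟩
  refine ⟨∑ s, C (φ (b s)) * X s, fun F => ?_⟩
  have hF : F = ∑ s, F.coeffs s • b s := by
    rw [Fintype.sum_sigma]
    funext p
    rw [Finset.sum_apply, Finset.sum_eq_single p]
    · apply Subtype.ext
      ext m
      simp only [b, Finset.sum_apply, Pi.smul_apply, Pi.single_eq_same, AddSubmonoidClass.coe_finsetSum,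
        SetLike.val_smul, coeff_sum, coeff_smul, coeff_monomial, smul_eq_mul, mul_ite, mul_one,
        mul_zero, FormSeq.coeffs]
      by_cases hm : m.degree = d p.1
      · rw [Finset.sum_eq_single ⟨m, hm⟩]
        · simp
        · intro x _ hx
          exact if_neg fun h => hx (Subtype.ext h)
        · simp
      · rw [IsHomogeneous.coeff_eq_zero (F p).2 hm, Finset.sum_eq_zero]
        intro x _
        exact if_neg fun h : x.1 = m => hm (h ▸ x.2)
    · intro p' _ hp'
      rw [Finset.sum_apply]
      refine Finset.sum_eq_zero fun m _ => ?_
      simp [b, Pi.single_eq_of_ne (Ne.symm hp')]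
    · simp
  conv_rhs => rw [hF]
  simp [mul_comm]

theorem isZariskiOpen_det_ne_zero {n k : ℕ} {d α : Fin k → ℕ} {Y : Type*} [AddCommGroup Y]
    [Module ℂ Y] [FiniteDimensional ℂ Y] (Θ : FormSeq n d α →ₗ[ℂ] Y →ₗ[ℂ] Y) :
    IsZariskiOpen {F | LinearMap.det (Θ F) ≠ 0} := by
  let b := Module.finBasis ℂ Y
  choose q hq using fun i j => exists_eval_coeffs_eq
    ((b.coord i).comp ((LinearMap.applyₗ (b j)).comp Θ))
  refine ⟨{(Matrix.of q).det}, ?_⟩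
  ext F
  have : eval F.coeffs (Matrix.of q).det = LinearMap.det (Θ F) := by
    rw [RingHom.map_det, ← LinearMap.det_toMatrix b]
    congr 1
    ext i j
    simp [hq, LinearMap.toMatrix_apply]
  simp [this]

/-- With `G` a left inverse at `F₀`, the condition `det (G ∘ M_F) ≠ 0` is open, holds at `F₀` and
forces injectivity. -/
theorem HoldsForGeneral.of_injective {n k : ℕ} {d α : Fin k → ℕ} {D : ℕ}
    {P : FormSeq n d α → Prop} {F₀ : FormSeq n d α}
    (h₀ : Function.Injective (seqMap d α D F₀))
    (h : ∀ F, Function.Injective (seqMap d α D F) → P F) : HoldsForGeneral P := by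
  obtain ⟨G, hG⟩ := (seqMap d α D F₀).exists_leftInverse_of_injective (LinearMap.ker_eq_bot.2 h₀)
  let Θ := (LinearMap.compRight ℂ G).comp (seqMap (n := n) d α D)
  have hΘ (F) : Θ F = G.comp (seqMap d α D F) := rfl
  refine ⟨_, isZariskiOpen_det_ne_zero Θ, ⟨F₀, ?_⟩, fun F hF => h F ?_⟩
  · change LinearMap.det (Θ F₀) ≠ 0
    simp [hΘ, hG]
  · have := (Module.End.isUnit_iff _).1
      ((LinearMap.isUnit_iff_isUnit_det (Θ F)).2 (isUnit_iff_ne_zero.2 hF))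
    exact Function.Injective.of_comp (f := G) this.1

/-- The same with a right inverse, after restricting the codomain to the forms of degree `D`. -/
theorem HoldsForGeneral.of_forms_le {n k : ℕ} {d α : Fin k → ℕ} {D : ℕ} (hd : ∀ i, d i ≤ D)
    {P : FormSeq n d α → Prop} {F₀ : FormSeq n d α}
    (h₀ : Forms n D ≤ (seqMap d α D F₀).range)
    (h : ∀ F, (seqMap d α D F).range = Forms n D → P F) : HoldsForGeneral P := by
  have hle (F : FormSeq n d α) : (seqMap d α D F).range ≤ Forms n D := by
    rw [range_seqMap hd]
    exact inf_le_right
  let Φ : FormSeq n d α →ₗ[ℂ] ((p : Σ i : Fin k, Fin (α i)) → Forms n (D - d p.1)) →ₗ[ℂ]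
      Forms n D :=
    { toFun := fun F => (seqMap d α D F).codRestrict (Forms n D) fun a => hle F ⟨a, rfl⟩
      map_add' := fun F F' => LinearMap.ext fun a => Subtype.ext (by simp)
      map_smul' := fun c F => LinearMap.ext fun a => Subtype.ext (by simp) }
  have hΦ (F a) : (Φ F a : MvPolynomial (Fin n) ℂ) = seqMap d α D F a := rfl
  obtain ⟨G, hG⟩ := (Φ F₀).exists_rightInverse_of_surjective (LinearMap.range_eq_top.2 fun x => by
    obtain ⟨a, ha⟩ := h₀ x.2
    exact ⟨a, Subtype.ext ha⟩)
  let Θ := (LinearMap.lcomp ℂ (Forms n D) G).comp Φ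
  have hΘ (F) : Θ F = (Φ F).comp G := rfl
  refine ⟨_, isZariskiOpen_det_ne_zero Θ, ⟨F₀, ?_⟩, fun F hF => h F (le_antisymm (hle F) ?_)⟩
  · change LinearMap.det (Θ F₀) ≠ 0
    simp [hΘ, hG]
  · intro x hx
    have := (Module.End.isUnit_iff _).1
      ((LinearMap.isUnit_iff_isUnit_det (Θ F)).2 (isUnit_iff_ne_zero.2 hF))
    obtain ⟨y, hy⟩ := this.2 ⟨x, hx⟩
    exact ⟨G y, congrArg Subtype.val hy⟩

/-! ### Existence of good sequences and the theorem -/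

theorem sum_sigma_subtype_fst_le {k : ℕ} (α : Fin k → ℕ) (i : Fin k) (g : Fin k → ℕ) :
    ∑ p : {p : Σ j : Fin k, Fin (α j) // p.1 ≤ i}, g p.1.1 = ∑ j ∈ Finset.Iic i, α j * g j := by
  rw [← Finset.sum_subtype (Finset.univ.filter fun p : Σ j : Fin k, Fin (α j) => p.1 ≤ i)
    (by simp) (fun p => g p.1), Finset.sum_filter, Fintype.sum_sigma,
    ← Finset.filter_ge_eq_Iic, Finset.sum_filter]
  refine Finset.sum_congr rfl fun j _ => ?_
  split_ifs <;> simp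

theorem exists_injective_seqMap {n k : ℕ} (d α : Fin k → ℕ) (D N : ℕ) (hd : ∀ i, d i ≤ D)
    (hN : ∀ i, formDim n (D - d i) ≤ N)
    (h : ∀ i, (∑ j ∈ Finset.Iic i, (α j : ℤ) * (formDim n (D - d j) : ℤ))
          + (N : ℤ) * ((formDim n (D - d i) : ℤ) - 1) < (formDim n D : ℤ)) :
    ∃ F : FormSeq n d α, Function.Injective (seqMap d α D F) := by
  have hcolon (i : Fin k) : ∀ᶠ f in genericFilter
      ({p : Σ j : Fin k, Fin (α j) // p.1 ≤ i} → MvPolynomial (Fin n) ℂ),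
      Module.finrank ℂ (formColon (D - d i) (d i) (formsSpan D (fun p => d p.1.1) f)) = 0 := by
    obtain ⟨κ, hκ⟩ := exists_generic_finrank_formColon (n := n) D
      (fun p : {p : Σ j : Fin k, Fin (α j) // p.1 ≤ i} => d p.1.1) (D - d i) (d i)
    obtain rfl | h0 := eq_or_ne κ 0
    · exact hκ
    exfalso
    obtain ⟨f, hf⟩ := hκ.exists
    have hκle : κ ≤ formDim n (D - d i) := by
      rw [← hf, ← finrank_forms]
      exact Submodule.finrank_le _
    -- As `κ ≥ 1`, the codimension is at most `N_{D-d_i} - 1`, the factor in the hypothesis.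
    have := formDim_le_of_formColon_ne_zero D (D - d i) (d i) N (Nat.add_sub_cancel' (hd i))
      (formDim n (D - d i) - 1) _ κ (fun p => hN _) hκ h0 (by omega)
    rw [sum_sigma_subtype_fst_le α i fun j => formDim n (D - d j)] at this
    have hi := h i
    zify [show 1 ≤ formDim n (D - d i) by omega] at this
    linarith
  have hgen : ∀ᶠ f in genericFilter ((Σ i : Fin k, Fin (α i)) → MvPolynomial (Fin n) ℂ), ∀ i,
      Module.finrank ℂ (formColon (D - d i) (d i) (formsSpan D
        (fun p : {p : Σ j : Fin k, Fin (α j) // p.1 ≤ i} => d p.1.1) fun p => f p.1)) = 0 ∧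
      ∀ a, formsMap D (fun p : {p : Σ j : Fin k, Fin (α j) // p.1 ≤ i} => d p.1.1)
        (fun p => f p.1) a = 0 → ∀ p, a p ∈ formColon (D - d p.1.1) (d p.1.1) (formsSpan D
          (fun p : {p : Σ j : Fin k, Fin (α j) // p.1 ≤ i} => d p.1.1) fun p => f p.1) := by
    rw [Filter.eventually_all]
    intro i
    let L : ((Σ i : Fin k, Fin (α i)) → MvPolynomial (Fin n) ℂ) →ₗ[ℂ]
        ({p : Σ j : Fin k, Fin (α j) // p.1 ≤ i} → MvPolynomial (Fin n) ℂ) :=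
      { toFun := fun z j => z j
        map_add' := fun z w => rfl
        map_smul' := fun t w => rfl }
    have hL : Function.Surjective L := fun w =>
      ⟨fun p => if h : p.1 ≤ i then w ⟨p, h⟩ else 0, by ext1 p; simp [L, p.2]⟩
    exact (tendsto_genericFilter L hL).eventually ((hcolon i).and
      (generic_mem_formColon_of_ker D _))
  obtain ⟨f, hf⟩ := hgen.exists
  refine ⟨toFormSeq d α f, ?_⟩
  rw [seqMap_toFormSeq, ← LinearMap.ker_eq_bot, LinearMap.ker_eq_bot']
  intro a ha
  by_contra hne
  -- Let `i` be the largest index with a nonzero coefficient. The syzygy involves only forms of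
  -- index at most `i`, so that coefficient lies in a zero colon space.
  obtain ⟨p, hp, hmax⟩ := Finset.exists_max_image
    (Finset.univ.filter fun p => a p ≠ 0) (fun p => p.1) (by
      obtain ⟨p, hp⟩ := Function.ne_iff.1 hne
      exact ⟨p, by simpa using hp⟩)
  obtain ⟨h1, h2⟩ := hf p.1
  have hp0 : a p ≠ 0 := by simpa using hp
  have h3 := h2 (fun q => a q.1) (by
    rw [formsMap_apply] at ha ⊢
    rw [← ha, ← Finset.sum_subtype (Finset.univ.filter fun q : Σ j : Fin k, Fin (α j) =>
      q.1 ≤ p.1) (by simp) (fun q => homogeneousComponent (d q.1) (f q) *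
        (a q : MvPolynomial (Fin n) ℂ))]
    refine Finset.sum_filter_of_ne fun q _ hq => hmax q ?_
    rw [Finset.mem_filter]
    exact ⟨Finset.mem_univ q, fun h0 => hq (by rw [h0, ZeroMemClass.coe_zero, mul_zero])⟩)
    ⟨p, le_rfl⟩
  rw [Submodule.finrank_eq_zero.1 h1] at h3
  exact hp0 h3

theorem exists_forms_le_range_seqMap {n k : ℕ} (d α : Fin k → ℕ) (D N : ℕ) (hd : ∀ i, d i ≤ D)
    (hN : formDim n D ≠ 0 → ∀ i, formDim n (D - d i) ≤ N)
    (h : (formDim n D : ℤ) + (k : ℤ) * (N : ℤ) * ((N : ℤ) - 1)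
          < ∑ i, (α i : ℤ) * (formDim n (D - d i) : ℤ)) :
    ∃ F : FormSeq n d α, Forms n D ≤ (seqMap d α D F).range := by
  by_contra! hcon
  have hV (f : (Σ i : Fin k, Fin (α i)) → MvPolynomial (Fin n) ℂ) :
      ¬ Forms n D ≤ formsSpan D (fun p => d p.1) f := by
    have := hcon (toFormSeq d α f)
    rwa [seqMap_toFormSeq] at this
  have hD0 : formDim n D ≠ 0 := by
    intro h0
    rw [← finrank_forms, Submodule.finrank_eq_zero] at h0
    refine hV 0 ?_
    rw [h0]
    exact bot_le
  replace hN := hN hD0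
  choose κ hκ using fun i => exists_generic_finrank_formColon (n := n) D
    (fun p : Σ i : Fin k, Fin (α i) => d p.1) (D - d i) (d i)
  -- A full colon space would give all forms of degree `D`, so each of the `k` dimensions is at most
  -- `N - 1`; hence `k (N - 1)` removals.
  have hκN (i) : κ i ≤ N - 1 := by
    obtain ⟨f, hf⟩ := (hκ i).exists
    have h1 : κ i < formDim n (D - d i) := by
      rw [← hf, ← finrank_forms]
      refine Submodule.finrank_lt fun htop => hV f ?_
      have := forms_le_of_formColon_eq_top htop
      rwa [Nat.add_sub_cancel' (hd i)] at this
    have := hN i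
    omega
  have hsum : ∑ i, κ i ≤ k * (N - 1) := by
    simpa using Finset.sum_le_sum fun i (_ : i ∈ Finset.univ) => hκN i
  have key := sum_formDim_le_of_forall_not_le D N d hd hN (k * (N - 1))
    (fun p : Σ i : Fin k, Fin (α i) => d p.1) κ (fun p => ⟨p.1, rfl⟩) hκ hV hsum
  rw [Fintype.sum_sigma] at key
  simp only [Finset.sum_const, Finset.card_univ, Fintype.card_fin, smul_eq_mul] at key
  rcases Nat.eq_zero_or_pos k with rfl | hk
  · simp at h
    omega
  have hN1 : 1 ≤ N := by
    by_contra! hN0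
    obtain rfl : N = 0 := by omega
    have h0 (i) : formDim n (D - d i) = 0 := Nat.le_zero.1 (hN i)
    simp [h0] at h
    omega
  zify [hN1] at key
  linarith

theorem mainTheorem5 (n k ℓ : ℕ) (hk : 0 < k) (d α : Fin k → ℕ) (hd : Monotone d)
    (dmin dmax : ℕ) (hdmin : dmin = d ⟨0, hk⟩)
    (hdmax : dmax = d ⟨k - 1, Nat.sub_one_lt_of_lt hk⟩) :
    ((∀ i : Fin k,
        (∑ j ∈ Finset.Iic i, (α j : ℤ) * (formDim n (ℓ + dmax - d j) : ℤ))
          + (formDim n (ℓ + dmax - dmin) : ℤ) * ((formDim n (ℓ + dmax - d i) : ℤ) - 1)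
          < (formDim n (ℓ + dmax) : ℤ)) →
      HoldsForGeneral fun f : FormSeq n d α =>
        hilbertFn f.ideal (dmax + ℓ) = ∑ i, α i * formDim n (ℓ + dmax - d i)) ∧
    ((formDim n (ℓ + dmax) : ℤ)
          + (k : ℤ) * (formDim n (ℓ + dmax - dmin) : ℤ) * ((formDim n (ℓ + dmax - dmin) : ℤ) - 1)
          < ∑ i, (α i : ℤ) * (formDim n (ℓ + dmax - d i) : ℤ) →
      HoldsForGeneral fun f : FormSeq n d α =>
        gradedComponent f.ideal (dmax + ℓ) = homogeneousSubmodule (Fin n) ℂ (dmax + ℓ)) := by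
  rw [add_comm dmax ℓ]
  have hmin (i) : dmin ≤ d i := hdmin ▸ hd (Fin.mk_le_mk.2 (Nat.zero_le _))
  have hmax (i) : d i ≤ dmax := hdmax ▸ hd (Fin.mk_le_mk.2 (by omega))
  generalize hD : ℓ + dmax = D
  have hdD (i) : d i ≤ D := (hmax i).trans (by omega)
  have hN (h0 : formDim n D ≠ 0) (i) : formDim n (D - d i) ≤ formDim n (D - dmin) :=
    formDim_le_formDim h0 (Nat.sub_le_sub_left (hmin i) D) (Nat.sub_le _ _)
  constructor
  · intro h
    -- Needed for monotonicity of `N_t` when `n = 0`. If `N_D = 0`, the hypothesis at the first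
    -- index fails, because `x (x - 1) ≥ 0` for natural `x`.
    have hD0 : formDim n D ≠ 0 := by
      intro h0
      have h1 := h ⟨0, hk⟩
      have h2 : 0 ≤ ∑ j ∈ Finset.Iic (⟨0, hk⟩ : Fin k),
          (α j : ℤ) * (formDim n (D - d j) : ℤ) := by positivity
      rw [h0, ← hdmin] at h1
      rcases Nat.eq_zero_or_pos (formDim n (D - dmin)) with h3 | h3
      · simp [h3] at h1
        omega
      · have h4 : (0 : ℤ) ≤ (formDim n (D - dmin) : ℤ) * ((formDim n (D - dmin) : ℤ) - 1) :=
          mul_nonneg (by omega) (by omega)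
        push_cast at h1
        linarith
    obtain ⟨F₀, hF₀⟩ := exists_injective_seqMap d α D _ hdD (hN hD0) h
    refine HoldsForGeneral.of_injective hF₀ fun F hF => ?_
    rw [hilbertFn, ← range_seqMap hdD, LinearMap.finrank_range_of_inj hF, finrank_formsMap_domain,
      Fintype.sum_sigma]
    simp
  · intro h
    obtain ⟨F₀, hF₀⟩ := exists_forms_le_range_seqMap d α D _ hdD hN h
    refine HoldsForGeneral.of_forms_le hdD hF₀ fun F hF => ?_
    rw [← range_seqMap hdD, hF]
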